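/- Let $\mathbb{F}$ be a division ring, $\sigma:\mathbb{F}\to\mathbb{F}$ a ring endomorphism and $\delta:\mathbb{F}\to\mathbb{F}$ a $\sigma$-derivation, i.e. an additive map with $\delta(ab)=\sigma(a)\delta(b)+\delta(a)b$ for all $a,b$. Let $\mathbb{F}[x;\sigma,\delta]$ be the skew polynomial ring: the left $\mathbb{F}$-vector space with basis $1,x,x^2,\dots$, with the ring product determined by $xa=\sigma(a)x+\delta(a)$ for $a\in\mathbb{F}$. We use the following notions. - For $F,P\in\mathbb{F}[x;\sigma,\delta]$ with $P\neq0$, $F(P)$ denotes the remainder of the Euclidean division of $F$ by $P$ on the right, that is, $F=QP+F(P)$ with $\deg F(P)<\deg P$. An element $b\in\mathbb{F}$ is a zero of $F$ if $F(x-b)=0$, i.e. if $x-b$ divides $F$ on the right. - For $\mathbf{a}=(a_1,\dots,a_r)\in\mathbb{F}^r$, $r\ge1$, put $P_{\mathbf{a}}=(x-a_r)\cdots(x-a_2)(x-a_1)$. The sequence $\mathbf{a}$ is a $(\sigma,\delta)$-multiplicity sequence if $a_1$ is the only zero of $P_{\mathbf{a}}$ in $\mathbb{F}$. Let $\mathcal{U}_2$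 be the set of all $P_{\mathbf{a}}$ with $\mathbf{a}$ a $(\sigma,\delta)$-multiplicity sequence. - For a set $\Omega$ of skew polynomials of degree at least $1$, let $I(\Omega)=\{F : F(P)=0 \text{ for all } P\in\Omega\}$. The set $\Omega$ is algebraic if $I(\Omega)\ne\{0\}$; in that case $F_\Omega$ denotes the unique monic skew polynomial of minimum degree among the non-zero elements of $I(\Omega)$. The set $\Omega$ is P-independent if it is finite, algebraic, and $\deg(F_\Omega)=\sum_{P\in\Omega}\deg(P)$. A subset $\Psi\subseteq\mathbb{F}$ is P-independent if $\{x-a : a\in\Psi\}$ is. - For $a\in\mathbb{F}$ and $\beta\in\mathbb{F}^*$ put $a^\beta=\sigma(\beta)a\beta^{-1}+\delta(\beta)\beta^{-1}$. An element $b$ is conjugate to $a$ if $b=a^\beta$ for some $\beta\in\mathbb{F}^*$. The centralizer of $a$ is the division subring $K_a^{\sigma,\delta}=\{\beta\in\mathbb{F} : \sigma(\beta)a+\delta(\beta)=a\beta\}$ of $\mathbb{F}$. **Theorem.** Let $\mathbf{a}_i=(a_{i,1},\dots,a_{i,r_i})\in\mathbb{F}^{r_i}$, $r_i\geq 1$,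 be a $(\sigma,\delta)$-multiplicity sequence for $i=1,\dots,n$, and assume that the first entries $a_{1,1},a_{2,1},\dots,a_{n,1}$ are distinct. Let $a_1,\dots,a_\ell\in\mathbb{F}$ be pairwise non-conjugate, and let $n_i\ge1$ and $\beta_{i,1},\dots,\beta_{i,n_i}\in\mathbb{F}^*$ for $i=1,\dots,\ell$ be such that $$\{a_{1,1},a_{2,1},\dots,a_{n,1}\}=\bigcup_{i=1}^{\ell}\left\{a_i^{\beta_{i,1}},\dots,a_i^{\beta_{i,n_i}}\right\}\qquad\text{and}\qquad n=n_1+\cdots+n_\ell .$$ Then the following are equivalent: 1. $\Omega=\{P_{\mathbf{a}_1},\dots,P_{\mathbf{a}_n}\}\subseteq\mathcal{U}_2$ is P-independent. 2. $\Psi=\{a_{1,1},a_{2,1},\dots,a_{n,1}\}\subseteq\mathbb{F}$ is P-independent. 3. For every $i=1,\dots,\ell$, the elements $\beta_{i,1},\dots,\beta_{i,n_i}$ are right linearly independent over $K_{a_i}^{\sigma,\delta}$. -/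

import Mathlib

/-- A `σ`-derivation of a division ring `F`, for a ring endomorphism `σ` of `F`: an additive map
`δ` with `δ (a b) = σ(a) δ(b) + δ(a) b`. -/
structure SigmaDerivation {F : Type*} [DivisionRing F] (σ : F →+* F) extends F →+ F where
  leibniz' : ∀ a b : F, toFun (a * b) = σ a * toFun b + toFun a * b

namespace SigmaDerivation

variable {F : Type*} [DivisionRing F] {σ : F →+* F}

instance : CoeFun (SigmaDerivation σ) (fun _ => F → F) := ⟨fun δ => δ.toAddMonoidHom⟩

theorem leibniz (δ : SigmaDerivation σ) (a b : F) : δ (a * b) = σ a * δ b + δ a * b :=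
  δ.leibniz' a b

theorem map_one (δ : SigmaDerivation σ) : δ 1 = 0 := by
  have h := δ.leibniz 1 1
  simpa using h

end SigmaDerivation

/-- The skew polynomial ring `F[x; σ, δ]`: the left `F`-vector space with basis `x ^ i`, `i ∈ ℕ`
(an element is its finitely supported sequence of left coefficients), with the product determined
by `x a = σ(a) x + δ(a)`. -/
def SkewPoly {F : Type*} [DivisionRing F] (σ : F →+* F) (_δ : SigmaDerivation σ) : Type _ :=
  ℕ →₀ F

namespace SkewPoly

variable {F : Type*} [DivisionRing F] (σ : F →+* F) (δ : SigmaDerivation σ)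

noncomputable instance : AddCommGroup (SkewPoly σ δ) := inferInstanceAs (AddCommGroup (ℕ →₀ F))

noncomputable instance : Module F (SkewPoly σ δ) := inferInstanceAs (Module F (ℕ →₀ F))

/-- The monomial `c x ^ i`. -/
noncomputable def monomial (i : ℕ) : F →+ SkewPoly σ δ := Finsupp.singleAddHom i

/-- The finitely supported sequence of left coefficients. -/
def toFinsupp {σ : F →+* F} {δ : SigmaDerivation σ} (f : SkewPoly σ δ) : ℕ →₀ F := f

/-- The coefficient of `x ^ i`. -/
def coeff {σ : F →+* F} {δ : SigmaDerivation σ} (f : SkewPoly σ δ) (i : ℕ) : F :=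
  f.toFinsupp i

/-- Left multiplication by `x`: it maps `c x ^ i` to `σ(c) x ^ (i + 1) + δ(c) x ^ i`. -/
noncomputable def mulX : AddMonoid.End (SkewPoly σ δ) :=
  Finsupp.liftAddHom fun i =>
    (monomial σ δ (i + 1)).comp σ.toAddMonoidHom + (monomial σ δ i).comp δ.toAddMonoidHom

/-- Left multiplication by `f = ∑ i, f_i x ^ i`, that is, `g ↦ ∑ i, f_i (x ^ i g)`. -/
noncomputable def mulLeftHom : SkewPoly σ δ →+ AddMonoid.End (SkewPoly σ δ) :=
  Finsupp.liftAddHom fun i =>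
    (AddMonoidHom.mulRight (mulX σ δ ^ i)).comp
      (Module.toAddMonoidEnd F (SkewPoly σ δ)).toAddMonoidHom

noncomputable instance : One (SkewPoly σ δ) := ⟨monomial σ δ 0 1⟩

noncomputable instance : Mul (SkewPoly σ δ) := ⟨fun f g => mulLeftHom σ δ f g⟩

theorem mul_def (f g : SkewPoly σ δ) : f * g = mulLeftHom σ δ f g := rfl

theorem one_def : (1 : SkewPoly σ δ) = monomial σ δ 0 1 := rfl

theorem mulLeftHom_add (f f' g : SkewPoly σ δ) :
    mulLeftHom σ δ (f + f') g = mulLeftHom σ δ f g + mulLeftHom σ δ f' g := by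
  rw [map_add]; rfl

theorem mulLeftHom_zero (g : SkewPoly σ δ) : mulLeftHom σ δ 0 g = 0 := by
  rw [map_zero]; rfl

theorem mulX_pow_succ (k : ℕ) (f : SkewPoly σ δ) :
    (mulX σ δ ^ (k + 1)) f = mulX σ δ ((mulX σ δ ^ k) f) := by
  rw [pow_succ']; rfl

theorem mulX_monomial (i : ℕ) (c : F) :
    mulX σ δ (monomial σ δ i c) = monomial σ δ (i + 1) (σ c) + monomial σ δ i (δ c) :=
  Finsupp.liftAddHom_apply_single _ _ _

theorem mulLeftHom_monomial (i : ℕ) (c : F) (g : SkewPoly σ δ) :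
    mulLeftHom σ δ (monomial σ δ i c) g = c • (mulX σ δ ^ i) g :=
  DFunLike.congr_fun (Finsupp.liftAddHom_apply_single
    (fun i => (AddMonoidHom.mulRight (mulX σ δ ^ i)).comp
      (Module.toAddMonoidEnd F (SkewPoly σ δ)).toAddMonoidHom) i c) g

theorem smul_monomial (a c : F) (i : ℕ) :
    a • monomial σ δ i c = monomial σ δ i (a * c) :=
  Finsupp.smul_single a i c

variable {σ δ} in
theorem addHom_ext {A : Type*} [AddZeroClass A] {φ ψ : SkewPoly σ δ →+ A}
    (h : ∀ i c, φ (monomial σ δ i c) = ψ (monomial σ δ i c)) : φ = ψ :=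
  Finsupp.addHom_ext h

variable {σ δ} in
@[elab_as_elim]
theorem induction_add {p : SkewPoly σ δ → Prop} (f : SkewPoly σ δ) (h0 : p 0)
    (hadd : ∀ f g, p f → p g → p (f + g)) (hm : ∀ i c, p (monomial σ δ i c)) : p f :=
  Finsupp.induction_linear (motive := p) f h0 hadd hm

theorem mulX_smul (a : F) (g : SkewPoly σ δ) :
    mulX σ δ (a • g) = σ a • mulX σ δ g + δ a • g := by
  induction g using induction_add with
  | h0 => simp
  | hadd f g hf hg => simp only [smul_add, map_add, hf, hg]; abel
  | hm i c =>
    simp only [smul_monomial, mulX_monomial, smul_add, map_mul, δ.leibniz, map_add]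
    abel

theorem mulLeftHom_smul (a : F) (f g : SkewPoly σ δ) :
    mulLeftHom σ δ (a • f) g = a • mulLeftHom σ δ f g := by
  induction f using induction_add with
  | h0 => simp
  | hadd f f' hf hf' => simp only [smul_add, mulLeftHom_add, hf, hf']
  | hm i c => simp only [smul_monomial, mulLeftHom_monomial, mul_smul]

theorem mulLeftHom_mulX (f g : SkewPoly σ δ) :
    mulLeftHom σ δ (mulX σ δ f) g = mulX σ δ (mulLeftHom σ δ f g) := by
  induction f using induction_add with
  | h0 => simp
  | hadd f f' hf hf' => rw [map_add (mulX σ δ), mulLeftHom_add, mulLeftHom_add, map_add, hf, hf']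
  | hm i c =>
    simp only [mulX_monomial, mulLeftHom_add, mulLeftHom_monomial, mulX_smul,
      mulX_pow_succ]

theorem mulLeftHom_mulX_pow (i : ℕ) (f g : SkewPoly σ δ) :
    mulLeftHom σ δ ((mulX σ δ ^ i) f) g = (mulX σ δ ^ i) (mulLeftHom σ δ f g) := by
  induction i with
  | zero => rfl
  | succ i ih => simp only [mulX_pow_succ, mulLeftHom_mulX, ih]

theorem mulX_pow_one (i : ℕ) : (mulX σ δ ^ i) (1 : SkewPoly σ δ) = monomial σ δ i 1 := by
  induction i with
  | zero => rfl
  | succ i ih =>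
    simp only [mulX_pow_succ, ih, mulX_monomial, _root_.map_one, δ.map_one,
      map_zero, add_zero]

protected theorem mul_assoc (f g h : SkewPoly σ δ) : f * g * h = f * (g * h) := by
  simp only [mul_def]
  induction f using induction_add with
  | h0 => simp
  | hadd f f' hf hf' => rw [mulLeftHom_add, mulLeftHom_add, mulLeftHom_add, hf, hf']
  | hm i c => simp only [mulLeftHom_monomial, mulLeftHom_smul, mulLeftHom_mulX_pow]

protected theorem one_mul (f : SkewPoly σ δ) : 1 * f = f := by
  simp only [mul_def, one_def, mulLeftHom_monomial, one_smul, pow_zero, AddMonoid.End.one_apply]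

protected theorem mul_one (f : SkewPoly σ δ) : f * 1 = f := by
  simp only [mul_def]
  induction f using induction_add with
  | h0 => simp
  | hadd f f' hf hf' => rw [mulLeftHom_add, hf, hf']
  | hm i c => simp only [mulLeftHom_monomial, mulX_pow_one, smul_monomial, _root_.mul_one]

noncomputable instance : Ring (SkewPoly σ δ) :=
  { (inferInstance : AddCommGroup (SkewPoly σ δ)),
    (inferInstance : Mul (SkewPoly σ δ)),
    (inferInstance : One (SkewPoly σ δ)) with
    left_distrib := fun f g h => map_add (mulLeftHom σ δ f) g h
    right_distrib := fun f g h => by simp only [mul_def, mulLeftHom_add]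
    zero_mul := fun f => by simp only [mul_def, mulLeftHom_zero]
    mul_zero := fun f => by simp only [mul_def, map_zero]
    mul_assoc := SkewPoly.mul_assoc σ δ
    one_mul := SkewPoly.one_mul σ δ
    mul_one := SkewPoly.mul_one σ δ }

/-- The embedding of `F` as the constants of `F[x; σ, δ]`. -/
noncomputable def C : F →+* SkewPoly σ δ :=
  { monomial σ δ 0 with
    map_one' := rfl
    map_mul' := fun a b => by
      change monomial σ δ 0 (a * b) = mulLeftHom σ δ (monomial σ δ 0 a) (monomial σ δ 0 b)
      simp only [mulLeftHom_monomial, pow_zero, AddMonoid.End.one_apply, smul_monomial] }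

/-- The indeterminate `x`. -/
noncomputable def X : SkewPoly σ δ := monomial σ δ 1 1

theorem C_mul (a : F) (f : SkewPoly σ δ) : C σ δ a * f = a • f := by
  change mulLeftHom σ δ (monomial σ δ 0 a) f = _
  simp only [mulLeftHom_monomial, pow_zero, AddMonoid.End.one_apply]

theorem X_mul (f : SkewPoly σ δ) : X σ δ * f = mulX σ δ f := by
  change mulLeftHom σ δ (monomial σ δ 1 1) f = _
  simp only [mulLeftHom_monomial, pow_one, one_smul]

/-- The defining relation `x a = σ(a) x + δ(a)`. -/
theorem X_mul_C (a : F) : X σ δ * C σ δ a = C σ δ (σ a) * X σ δ + C σ δ (δ a) := by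
  rw [X_mul, C_mul, X, smul_monomial, _root_.mul_one]
  exact mulX_monomial σ δ 0 a

/-- The monomials are the left multiples of the powers of `x`. -/
theorem monomial_eq (i : ℕ) (c : F) : monomial σ δ i c = C σ δ c * X σ δ ^ i := by
  have h : X σ δ ^ i = monomial σ δ i 1 := by
    induction i with
    | zero => rfl
    | succ i ih =>
      rw [pow_succ', ih, X_mul, mulX_monomial, _root_.map_one, δ.map_one, map_zero, add_zero]
  rw [h, C_mul, smul_monomial, _root_.mul_one]

variable {σ δ}

/-- The degree of a skew polynomial, with `deg 0 = -∞` written as `⊥`. -/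
def degree (f : SkewPoly σ δ) : WithBot ℕ := f.toFinsupp.support.max

@[ext]
theorem ext {f g : SkewPoly σ δ} (h : ∀ i, f.coeff i = g.coeff i) : f = g := Finsupp.ext h

@[simp] theorem coeff_zero (i : ℕ) : (0 : SkewPoly σ δ).coeff i = 0 := rfl

@[simp] theorem coeff_add (f g : SkewPoly σ δ) (i : ℕ) :
    (f + g).coeff i = f.coeff i + g.coeff i := rfl

@[simp] theorem coeff_neg (f : SkewPoly σ δ) (i : ℕ) : (-f).coeff i = -f.coeff i := rfl

@[simp] theorem coeff_sub (f g : SkewPoly σ δ) (i : ℕ) :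
    (f - g).coeff i = f.coeff i - g.coeff i := rfl

@[simp] theorem coeff_smul (a : F) (f : SkewPoly σ δ) (i : ℕ) :
    (a • f).coeff i = a * f.coeff i := rfl

theorem coeff_monomial (i j : ℕ) (c : F) :
    (monomial σ δ i c).coeff j = if i = j then c else 0 :=
  Finsupp.single_apply

theorem degree_lt_iff (f : SkewPoly σ δ) (n : ℕ) :
    f.degree < n ↔ ∀ i, n ≤ i → f.coeff i = 0 := by
  refine (Finset.sup_lt_iff (WithBot.bot_lt_coe n)).trans ?_
  constructor
  · intro h i hi
    by_contra h0
    have h1 := h i (Finsupp.mem_support_iff.2 h0)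
    exact absurd (WithBot.coe_lt_coe.1 h1) (not_lt.2 hi)
  · intro h i hi
    have h0 : f.coeff i ≠ 0 := Finsupp.mem_support_iff.1 hi
    have : i < n := by
      by_contra h1
      exact h0 (h i (not_lt.1 h1))
    exact WithBot.coe_lt_coe.2 this

theorem degree_eq_iff (f : SkewPoly σ δ) (n : ℕ) :
    f.degree = n ↔ f.coeff n ≠ 0 ∧ ∀ i, n < i → f.coeff i = 0 := by
  have h1 := degree_lt_iff f n
  have h2 := degree_lt_iff f (n + 1)
  have h3 : f.degree < ((n + 1 : ℕ) : WithBot ℕ) ↔ f.degree ≤ n := by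
    induction f.degree with
    | bot => simp
    | coe k => exact WithBot.coe_lt_coe.trans (Nat.lt_succ_iff.trans WithBot.coe_le_coe.symm)
  constructor
  · intro h
    have hz : ∀ i, n < i → f.coeff i = 0 := fun i hi => h2.1 (h3.2 h.le) i hi
    refine ⟨fun h0 => ?_, hz⟩
    refine absurd (h1.2 fun i hi => ?_) h.not_lt
    rcases hi.eq_or_lt with rfl | hi
    · exact h0
    · exact hz i hi
  · rintro ⟨h0, hz⟩
    refine le_antisymm (h3.1 (h2.2 fun i hi => hz i hi)) (not_lt.1 fun h => h0 (h1.1 h n le_rfl))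

theorem degree_eq_bot (f : SkewPoly σ δ) : f.degree = ⊥ ↔ f = 0 := by
  rw [degree, Finset.max_eq_bot]
  exact Finsupp.support_eq_empty

theorem exists_degree_eq {f : SkewPoly σ δ} (hf : f ≠ 0) : ∃ n : ℕ, f.degree = n :=
  (WithBot.ne_bot_iff_exists.1 (mt (degree_eq_bot f).1 hf)).imp fun _ h => h.symm

theorem coeff_mulX_succ (f : SkewPoly σ δ) (i : ℕ) :
    (mulX σ δ f).coeff (i + 1) = σ (f.coeff i) + δ (f.coeff (i + 1)) := by
  induction f using induction_add with
  | h0 => simp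
  | hadd f g hf hg => simp only [map_add, coeff_add, hf, hg]; abel
  | hm j c =>
    simp only [mulX_monomial, coeff_add, coeff_monomial, add_left_inj]
    split_ifs <;> simp

theorem coeff_mulX_pow {f : SkewPoly σ δ} {n : ℕ} (hf : ∀ i, n < i → f.coeff i = 0) (k : ℕ) :
    ((mulX σ δ ^ k) f).coeff (n + k) = (σ ^ k) (f.coeff n) ∧
      ∀ i, n + k < i → ((mulX σ δ ^ k) f).coeff i = 0 := by
  induction k with
  | zero => exact ⟨rfl, hf⟩
  | succ k ih =>
    obtain ⟨h1, h2⟩ := ih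
    simp only [mulX_pow_succ, ← add_assoc, coeff_mulX_succ, h1, pow_succ' σ]
    refine ⟨by rw [h2 _ (by omega), map_zero, add_zero]; rfl, fun i hi => ?_⟩
    obtain ⟨j, rfl⟩ : ∃ j, i = j + 1 := ⟨i - 1, by omega⟩
    rw [coeff_mulX_succ, h2 _ (by omega), h2 _ (by omega), map_zero, map_zero, add_zero]

theorem coeff_mul (f g : SkewPoly σ δ) (i : ℕ) :
    (f * g).coeff i = f.toFinsupp.sum fun k c => c * ((mulX σ δ ^ k) g).coeff i := by
  rw [mul_def]
  induction f using induction_add with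
  | h0 => rw [mulLeftHom_zero]; exact Finsupp.sum_zero_index.symm
  | hadd f f' hf hf' =>
    rw [mulLeftHom_add, coeff_add, hf, hf']
    exact (Finsupp.sum_add_index' (fun _ => zero_mul _) (fun _ _ _ => add_mul _ _ _)).symm
  | hm k c =>
    rw [mulLeftHom_monomial, coeff_smul]
    exact (Finsupp.sum_single_index (h := fun k c => c * ((mulX σ δ ^ k) g).coeff i)
      (zero_mul _)).symm

theorem degree_mul (f g : SkewPoly σ δ) : (f * g).degree = f.degree + g.degree := by
  by_cases hf : f = 0
  · subst hf; rw [zero_mul, (degree_eq_bot _).2 rfl, WithBot.bot_add]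
  by_cases hg : g = 0
  · subst hg; rw [mul_zero, (degree_eq_bot _).2 rfl, WithBot.add_bot]
  obtain ⟨m, hm⟩ := exists_degree_eq hf
  obtain ⟨n, hn⟩ := exists_degree_eq hg
  rw [hm, hn]
  refine (degree_eq_iff (f * g) (m + n)).2 ?_
  obtain ⟨hm1, hm2⟩ := (degree_eq_iff f m).1 hm
  obtain ⟨hn1, hn2⟩ := (degree_eq_iff g n).1 hn
  have key : ∀ k, k ∈ f.toFinsupp.support → k ≤ m := fun k hk => by
    by_contra h
    exact Finsupp.mem_support_iff.1 hk (hm2 k (not_le.1 h))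
  constructor
  · rw [coeff_mul, Finsupp.sum, Finset.sum_eq_single m]
    · rw [add_comm m n, (coeff_mulX_pow hn2 m).1]
      exact mul_ne_zero hm1 ((map_ne_zero (σ ^ m)).2 hn1)
    · intro k hk hkm
      have := key k hk
      rw [(coeff_mulX_pow hn2 k).2 _ (by omega), mul_zero]
    · intro h
      exact absurd (Finsupp.mem_support_iff.2 hm1) h
  · intro i hi
    rw [coeff_mul, Finsupp.sum]
    refine Finset.sum_eq_zero fun k hk => ?_
    have := key k hk
    rw [(coeff_mulX_pow hn2 k).2 _ (by omega), mul_zero]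

/-- Euclidean division on the right. -/
theorem exists_remainder (f p : SkewPoly σ δ) (hp : p ≠ 0) :
    ∃ r : SkewPoly σ δ, r.degree < p.degree ∧ ∃ q, f = q * p + r := by
  obtain ⟨n, hn⟩ := exists_degree_eq hp
  obtain ⟨hn1, hn2⟩ := (degree_eq_iff p n).1 hn
  suffices H : ∀ m : ℕ, ∀ f : SkewPoly σ δ, f.degree < m →
      ∃ r : SkewPoly σ δ, r.degree < p.degree ∧ ∃ q, f = q * p + r by
    by_cases hf : f = 0
    · exact ⟨0, by rw [(degree_eq_bot _).2 rfl, hn]; exact WithBot.bot_lt_coe n, 0, by simp [hf]⟩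
    · obtain ⟨m, hm⟩ := exists_degree_eq hf
      exact H (m + 1) f (by rw [hm]; exact WithBot.coe_lt_coe.2 m.lt_succ_self)
  intro m
  induction m with
  | zero =>
    intro f hf
    have : f = 0 := ext fun i => (degree_lt_iff f 0).1 hf i i.zero_le
    exact ⟨0, by rw [(degree_eq_bot _).2 rfl, hn]; exact WithBot.bot_lt_coe n, 0, by simp [this]⟩
  | succ m ih =>
    intro f hf
    by_cases hmn : m < n
    · refine ⟨f, hf.trans_le ?_, 0, by simp⟩
      rw [hn]
      exact WithBot.coe_le_coe.2 hmn
    · obtain ⟨k, rfl⟩ : ∃ k, m = n + k := ⟨m - n, by omega⟩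
      obtain ⟨hk1, hk2⟩ := coeff_mulX_pow hn2 k
      have hσ : (σ ^ k) (p.coeff n) ≠ 0 := (map_ne_zero (σ ^ k)).2 hn1
      set c : F := f.coeff (n + k) * ((σ ^ k) (p.coeff n))⁻¹ with hc
      have hmul : monomial σ δ k c * p = c • (mulX σ δ ^ k) p := mulLeftHom_monomial σ δ k c p
      obtain ⟨r, hr, q, hq⟩ := ih (f - monomial σ δ k c * p) (by
        rw [degree_lt_iff]
        intro i hi
        rw [hmul, coeff_sub, coeff_smul]
        rcases hi.eq_or_lt with rfl | hi
        · rw [hk1, hc, mul_assoc, inv_mul_cancel₀ hσ, _root_.mul_one, sub_self]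
        · rw [hk2 i hi, (degree_lt_iff f _).1 hf i hi, mul_zero, sub_zero])
      exact ⟨r, hr, q + monomial σ δ k c, by rw [add_mul, add_right_comm, ← hq, sub_add_cancel]⟩

theorem degree_sub_lt {f g : SkewPoly σ δ} {d : WithBot ℕ} (hf : f.degree < d)
    (hg : g.degree < d) : (f - g).degree < d := by
  induction d with
  | bot => exact absurd hf not_lt_bot
  | coe n =>
    refine (degree_lt_iff _ n).2 fun i hi => ?_
    rw [coeff_sub, (degree_lt_iff f n).1 hf i hi, (degree_lt_iff g n).1 hg i hi, sub_zero]

/-- The remainder in the Euclidean division on the right is unique. -/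
theorem remainder_unique (p r r' q q' : SkewPoly σ δ) (hr : r.degree < p.degree)
    (hr' : r'.degree < p.degree) (h : q * p + r = q' * p + r') : r = r' := by
  have h1 : (q - q') * p = r' - r := by
    rw [sub_mul, sub_eq_sub_iff_add_eq_add, h, add_comm]
  have h2 : ((q - q') * p).degree < p.degree := h1 ▸ degree_sub_lt hr' hr
  by_cases hq : q - q' = 0
  · rw [hq, zero_mul] at h1
    exact (sub_eq_zero.1 h1.symm).symm
  · obtain ⟨m, hm⟩ := exists_degree_eq hq
    rw [degree_mul, hm] at h2
    refine absurd h2 (not_lt.2 (le_add_of_nonneg_left ?_))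
    exact WithBot.coe_le_coe.2 m.zero_le

open Classical in
/-- The evaluation `f(p)` of `f` at a skew polynomial `p ≠ 0`: the remainder of `f` in the
Euclidean division by `p` on the right. -/
noncomputable def eval (f p : SkewPoly σ δ) : SkewPoly σ δ :=
  if hp : p = 0 then f else (exists_remainder f p hp).choose

theorem eval_spec (f p : SkewPoly σ δ) (hp : p ≠ 0) :
    (eval f p).degree < p.degree ∧ ∃ q, f = q * p + eval f p := by
  rw [eval, dif_neg hp]
  exact (exists_remainder f p hp).choose_spec

/-- The zeros of `f` in `F`: those `b` with `f(x - b) = 0`. -/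
def zeros (f : SkewPoly σ δ) : Set F := {b | eval f (X σ δ - C σ δ b) = 0}

/-- The skew polynomials that vanish at every element of `Ω`. -/
def vanishing (Ω : Set (SkewPoly σ δ)) : Set (SkewPoly σ δ) := {f | ∀ p ∈ Ω, eval f p = 0}

/-- `Ω` is algebraic if some non-zero skew polynomial vanishes at every element of `Ω`. -/
def Algebraic (Ω : Set (SkewPoly σ δ)) : Prop := vanishing Ω ≠ {0}

/-- The coefficient of the highest power of `x` is one (in particular `f ≠ 0`). -/
def Monic (f : SkewPoly σ δ) : Prop := ∃ n : ℕ, f.degree = n ∧ f.coeff n = 1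

/-- `f` is a monic skew polynomial vanishing at `Ω`, of least degree among the non-zero ones. -/
def IsMinimal (Ω : Set (SkewPoly σ δ)) (f : SkewPoly σ δ) : Prop :=
  f ∈ vanishing Ω ∧ f.Monic ∧ ∀ g ∈ vanishing Ω, g ≠ 0 → f.degree ≤ g.degree

theorem eval_eq_zero_iff (f p : SkewPoly σ δ) (hp : p ≠ 0) : eval f p = 0 ↔ ∃ q, f = q * p := by
  obtain ⟨h1, q, hq⟩ := eval_spec f p hp
  constructor
  · intro h
    exact ⟨q, by rw [h, add_zero] at hq; exact hq⟩
  · rintro ⟨q', hq'⟩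
    refine remainder_unique p _ _ q q' h1 ?_ (by rw [← hq, add_zero, hq'])
    rw [(degree_eq_bot _).2 rfl, bot_lt_iff_ne_bot]
    exact mt (degree_eq_bot p).1 hp

theorem eval_zero_iff (f p : SkewPoly σ δ) : eval f p = 0 ↔ ∃ q, f = q * p := by
  by_cases hp : p = 0
  · subst hp; simp [eval]
  · exact eval_eq_zero_iff f p hp

theorem zero_mem_vanishing (Ω : Set (SkewPoly σ δ)) : (0 : SkewPoly σ δ) ∈ vanishing Ω :=
  fun p _ => (eval_zero_iff _ _).2 ⟨0, by simp⟩

theorem exists_isMinimal {Ω : Set (SkewPoly σ δ)} (h : Algebraic Ω) : ∃ f, IsMinimal Ω f := by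
  have h0 : ∃ n : ℕ, ∃ f ∈ vanishing Ω, f.degree = n := by
    by_contra hc
    push Not at hc
    refine h (Set.eq_singleton_iff_unique_mem.2 ⟨zero_mem_vanishing Ω, fun f hf => ?_⟩)
    by_contra hf0
    obtain ⟨n, hn⟩ := exists_degree_eq hf0
    exact hc n f hf hn
  classical
  obtain ⟨f, hf, hn⟩ := Nat.find_spec h0
  set n := Nat.find h0
  obtain ⟨h1, h2⟩ := (degree_eq_iff f n).1 hn
  have hd : ((f.coeff n)⁻¹ • f).degree = n := by
    rw [degree_eq_iff]
    refine ⟨by rw [coeff_smul, inv_mul_cancel₀ h1]; exact one_ne_zero, fun i hi => ?_⟩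
    rw [coeff_smul, h2 i hi, mul_zero]
  refine ⟨(f.coeff n)⁻¹ • f, fun p hp => ?_, ⟨n, hd, ?_⟩, fun g hg hg0 => ?_⟩
  · obtain ⟨q, hq⟩ := (eval_zero_iff f p).1 (hf p hp)
    exact (eval_zero_iff _ _).2 ⟨C σ δ (f.coeff n)⁻¹ * q, by rw [mul_assoc, ← hq, C_mul]⟩
  · rw [coeff_smul, inv_mul_cancel₀ h1]
  · obtain ⟨m, hm⟩ := exists_degree_eq hg0
    rw [hd, hm]
    exact WithBot.coe_le_coe.2 (Nat.find_min' h0 ⟨g, hg, hm⟩)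

/-- The minimal skew polynomial of a set is unique. -/
theorem IsMinimal.unique {Ω : Set (SkewPoly σ δ)} {f g : SkewPoly σ δ} (hf : IsMinimal Ω f)
    (hg : IsMinimal Ω g) : f = g := by
  obtain ⟨hf1, ⟨m, hm, hm1⟩, hf3⟩ := hf
  obtain ⟨hg1, ⟨n, hn, hn1⟩, hg3⟩ := hg
  have hf0 : f ≠ 0 := fun h => by simp [(degree_eq_bot f).2 h] at hm
  have hg0 : g ≠ 0 := fun h => by simp [(degree_eq_bot g).2 h] at hn
  have hmn : m = n := by
    have h := le_antisymm (hf3 g hg1 hg0) (hg3 f hf1 hf0)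
    rw [hm, hn] at h
    exact WithBot.coe_injective h
  subst hmn
  by_contra hne
  have hsub : f - g ∈ vanishing Ω := fun p hp => by
    obtain ⟨q, hq⟩ := (eval_zero_iff f p).1 (hf1 p hp)
    obtain ⟨q', hq'⟩ := (eval_zero_iff g p).1 (hg1 p hp)
    exact (eval_zero_iff _ _).2 ⟨q - q', by rw [sub_mul, ← hq, ← hq']⟩
  refine absurd (hf3 _ hsub (sub_ne_zero.2 hne)) (not_le.2 ?_)
  rw [hm, degree_lt_iff]
  intro i hi
  rcases hi.eq_or_lt with rfl | hi
  · rw [coeff_sub, hm1, hn1, sub_self]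
  · rw [coeff_sub, ((degree_eq_iff f m).1 hm).2 i hi, ((degree_eq_iff g m).1 hn).2 i hi, sub_zero]

open Classical in
/-- The minimal skew polynomial `F_Ω` of `Ω`; it is `0` if `Ω` is not algebraic. -/
noncomputable def minPoly (Ω : Set (SkewPoly σ δ)) : SkewPoly σ δ :=
  if h : Algebraic Ω then (exists_isMinimal h).choose else 0

theorem minPoly_spec {Ω : Set (SkewPoly σ δ)} (h : Algebraic Ω) : IsMinimal Ω (minPoly Ω) := by
  rw [minPoly, dif_pos h]
  exact (exists_isMinimal h).choose_spec

/-- `Ω ⊆ U` is P-independent if it is finite, algebraic, and `deg F_Ω = ∑ P ∈ Ω, deg P`. -/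
def PIndependent (U Ω : Set (SkewPoly σ δ)) : Prop :=
  Ω ⊆ U ∧ Algebraic Ω ∧ ∃ hfin : Ω.Finite, (minPoly Ω).degree = ∑ p ∈ hfin.toFinset, p.degree

variable (σ δ)

/-- `P_a = (x - a_r) ⋯ (x - a_2) (x - a_1)` for a sequence `a = (a_1, …, a_r)`, which is indexed
here by `0, …, r - 1`. -/
noncomputable def seqPoly : {r : ℕ} → (Fin r → F) → SkewPoly σ δ
  | 0, _ => 1
  | r + 1, a => (X σ δ - C σ δ (a (Fin.last r))) * seqPoly fun i : Fin r => a i.castSucc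

/-- A sequence `a = (a_1, …, a_r)` with `r ≥ 1` is a `(σ, δ)`-multiplicity sequence if `a_1` is
the only zero of `P_a` in `F`. -/
def IsMultiplicitySeq {r : ℕ} (a : Fin r → F) : Prop :=
  ∃ hr : 0 < r, zeros (seqPoly σ δ a) = {a ⟨0, hr⟩}

/-- The set of all `x - a` with `a ∈ F`. -/
def univ₀ : Set (SkewPoly σ δ) := {p | ∃ a : F, p = X σ δ - C σ δ a}

/-- The set of all `P_a`, where `a` is a `(σ, δ)`-multiplicity sequence. -/
def univ₂ : Set (SkewPoly σ δ) :=
  {p | ∃ (r : ℕ) (a : Fin r → F), IsMultiplicitySeq σ δ a ∧ p = seqPoly σ δ a}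

/-- A set of points of `F` is P-independent if the corresponding set of linear skew polynomials
`x - a` is. -/
def PIndependentPoints (Ψ : Set F) : Prop :=
  PIndependent (univ₀ σ δ) ((fun a => X σ δ - C σ δ a) '' Ψ)

/-- `a ^ β = σ(β) a β⁻¹ + δ(β) β⁻¹`, for `β ≠ 0`. -/
def conj (a β : F) : F := σ β * a * β⁻¹ + δ β * β⁻¹

/-- `b` is a `(σ, δ)`-conjugate of `a`. -/
def IsConjugate (a b : F) : Prop := ∃ β : F, β ≠ 0 ∧ b = conj σ δ a β

/-- The `(σ, δ)`-centralizer of `a`, a division subring of `F`. -/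
def centralizer (a : F) : Subfield F where
  carrier := {β | σ β * a + δ β = a * β}
  mul_mem' := by
    intro β γ hβ hγ
    simp only [Set.mem_ofPred_eq] at *
    rw [map_mul, δ.leibniz, mul_assoc, ← add_assoc, ← mul_add, hγ, ← mul_assoc, ← add_mul, hβ,
      mul_assoc]
  one_mem' := by simp [δ.map_one]
  add_mem' := by
    intro β γ hβ hγ
    simp only [Set.mem_ofPred_eq] at *
    rw [map_add, map_add, add_mul, mul_add, ← hβ, ← hγ]
    abel
  zero_mem' := by simp
  neg_mem' := by
    intro β hβ
    simp only [Set.mem_ofPred_eq] at *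
    rw [map_neg, map_neg, neg_mul, mul_neg, ← hβ, neg_add]
  inv_mem' := by
    intro β hβ
    simp only [Set.mem_ofPred_eq] at *
    by_cases h0 : β = 0
    · simp [h0]
    have hσ : σ β ≠ 0 := (map_ne_zero σ).2 h0
    have h1 : σ β * δ β⁻¹ + δ β * β⁻¹ = 0 := by
      rw [← δ.leibniz, mul_inv_cancel₀ h0, δ.map_one]
    apply mul_left_cancel₀ hσ
    have h2 : σ β * (a * β⁻¹) = a - δ β * β⁻¹ := by
      rw [← mul_assoc, eq_sub_of_add_eq hβ, sub_mul, mul_assoc, mul_inv_cancel₀ h0, _root_.mul_one]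
    rw [h2, mul_add, ← mul_assoc, ← map_mul, mul_inv_cancel₀ h0, _root_.map_one, _root_.one_mul,
      eq_neg_of_add_eq_zero_left h1, sub_eq_add_neg]

/-- Right linear independence of a family `β` over a division subring `K` of `F`: for the right
multiplication of `K` on `F`, that is, for the left action on `F` of the opposite ring of `K`,
viewed as a subring of the opposite ring of `F`. -/
def RightLinearIndependent {ι : Type*} (K : Subfield F) (β : ι → F) : Prop :=
  LinearIndependent K.toSubring.op β

end SkewPoly

/-! Write `R` for the skew polynomial ring. Everything is translated into the surjectivity of
diagonal maps `R → ∏ R / R p_i`. The kernel of such a map is `R F_Ω`, so its image has `F`-dimension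
`deg F_Ω`, while the target has dimension `∑ deg p_i`. P-independence is therefore a Chinese
remainder property (`pIndependent_range_iff`).

1 ↔ 2: since `P_a` is a left multiple of `x - a_1`, solving congruences modulo the `P_a` solves them
modulo the `x - a_1`. Conversely, a maximal left ideal containing a product of linear factors has
the form `R (x - b)`, so the multiplicity condition says that `R (x - a_1)` is the only maximal left
ideal above `R P_a` (`IsMultiplicitySeq.eq_span_of_isCoatom`). A failure of surjectivity is always
visible in a simple quotient of the product, and maps from `R / R P_a` to a simple module factor
through `R / R (x - a_1)`, so surjectivity lifts (`surjective_pi_mkQ_of_forall_isCoatom`).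

2 ↔ 3: in a module where a non-zero `w` is killed by `x - c`, the vector `γ w` with `γ ≠ 0` is
killed by `x - b` exactly when `b` is the conjugate of `c` by `γ`. Linear relations between such
vectors in a simple module are then right linear relations between the `β_{i,j}` over one
centralizer, because non-conjugate points cannot share a simple module
(`surjective_pi_mkQ_conj_iff`). -/

namespace Submodule

/-! ### Diagonal maps into products of cyclic modules over an arbitrary ring -/

variable {R : Type*} [Ring R] {ι : Type*} [Fintype ι]

/-- If the diagonal map `R → ∏ R / I i` is not surjective, there are maps from the `R / I i` to a
simple module, not all zero, whose sum kills its image. -/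
theorem exists_of_not_surjective_pi_mkQ (I : ι → Submodule R R)
    (h : ¬ Function.Surjective (LinearMap.pi fun i => (I i).mkQ)) :
    ∃ L : Submodule R (∀ i, R ⧸ I i), IsCoatom L ∧ ∃ φ : ι → R →ₗ[R] (∀ i, R ⧸ I i) ⧸ L,
      (∀ i, I i ≤ LinearMap.ker (φ i)) ∧ (∀ f, ∑ i, φ i f = 0) ∧ ∃ i, φ i ≠ 0 := by
  classical
  -- A finite product of cyclic modules is finitely generated, so a proper submodule lies in a
  -- maximal one.
  obtain ⟨L, hL, hle⟩ :=
    (eq_top_or_exists_le_coatom _).resolve_left fun h' => h (LinearMap.range_eq_top.1 h')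
  let φ : ι → R →ₗ[R] (∀ i, R ⧸ I i) ⧸ L := fun i =>
    L.mkQ ∘ₗ LinearMap.single R (fun i => R ⧸ I i) i ∘ₗ (I i).mkQ
  have hφ : ∀ g : ι → R, ∑ i, φ i (g i) = L.mkQ (fun i => (I i).mkQ (g i)) := fun g => by
    simp only [φ, LinearMap.comp_apply, ← map_sum, LinearMap.coe_single]
    rw [Finset.univ_sum_single fun i => (I i).mkQ (g i)]
  refine ⟨L, hL, φ, fun i x hx => ?_, fun f => ?_, ?_⟩
  · have : (I i).mkQ x = 0 := by simpa using hx
    simp only [LinearMap.mem_ker, φ, LinearMap.comp_apply, this, map_zero]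
  · rw [hφ fun _ => f]
    exact (Submodule.Quotient.mk_eq_zero L).2 (hle ⟨f, rfl⟩)
  · by_contra! h0
    -- If every component vanished, each tuple would be zero modulo `L`, so `L` would not be proper.
    refine hL.1 (eq_top_iff.2 fun y _ => (Submodule.Quotient.mk_eq_zero L).1 ?_)
    choose g hg using fun i => (I i).mkQ_surjective (y i)
    rw [← funext hg]
    change L.mkQ _ = 0
    rw [← hφ]
    exact Finset.sum_eq_zero fun i _ => by rw [h0, LinearMap.zero_apply]

/-- If `J i` is the only maximal left ideal containing `I i`, then surjectivity of the diagonal map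
lifts from `∏ R / J i` to `∏ R / I i`. -/
theorem surjective_pi_mkQ_of_forall_isCoatom (I J : ι → Submodule R R)
    (hIJ : ∀ i, ∀ m : Submodule R R, IsCoatom m → I i ≤ m → m = J i)
    (hJ : Function.Surjective (LinearMap.pi fun i => (J i).mkQ)) :
    Function.Surjective (LinearMap.pi fun i => (I i).mkQ) := by
  classical
  by_contra h
  obtain ⟨L, hL, φ, hker, hsum, i, hi⟩ := exists_of_not_surjective_pi_mkQ I h
  have : IsSimpleModule R ((∀ i, R ⧸ I i) ⧸ L) := isSimpleModule_iff_isCoatom.2 hL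
  have hker' : ∀ k, J k ≤ LinearMap.ker (φ k) := fun k => by
    -- A non-zero map to a simple module is onto, so its kernel is a maximal left ideal; containing
    -- `I k`, it must be `J k`.
    rcases LinearMap.surjective_or_eq_zero (φ k) with hs | h0
    · exact (hIJ k _ (LinearMap.isCoatom_ker_of_surjective hs) (hker k)).ge
    · rw [h0, LinearMap.ker_zero]; exact le_top
  refine hi (LinearMap.ext fun g => ?_)
  -- With `f` congruent to `g` modulo `J i` and lying in every other `J k`, the relation `∑ φ k f =
  -- 0` reduces to `φ i g = 0`.
  obtain ⟨f, hf⟩ := hJ (Pi.single i ((J i).mkQ g))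
  have hf' : ∀ k, (J k).mkQ f = Pi.single (M := fun k => R ⧸ J k) i ((J i).mkQ g) k := congrFun hf
  have hi' : φ i (f - g) = 0 := hker' i ((Submodule.Quotient.eq _).1 (by
    have := hf' i
    rwa [Pi.single_eq_same] at this))
  have h0 := hsum f
  rw [Finset.sum_eq_single i (fun k _ hk => hker' k ((Submodule.Quotient.mk_eq_zero _).1 (by
    have := hf' k
    rwa [Pi.single_eq_of_ne hk] at this))) (by simp)] at h0
  rwa [map_sub, h0, zero_sub, neg_eq_zero] at hi'

end Submodule

namespace SkewPoly

/-! ### Linear factors and the vectors they kill -/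

variable {F : Type*} [DivisionRing F] {σ : F →+* F} {δ : SigmaDerivation σ}

/-- Makes the quotients by left ideals into left `F`-spaces, so that dimensions can be counted. -/
instance : IsScalarTower F (SkewPoly σ δ) (SkewPoly σ δ) where
  smul_assoc a f g := mulLeftHom_smul σ δ a f g

theorem C_eq_monomial (a : F) : C σ δ a = monomial σ δ 0 a := rfl

theorem degree_X_sub_C (b : F) : (X σ δ - C σ δ b).degree = (1 : ℕ) := by
  rw [degree_eq_iff]
  simp only [coeff_sub, X, C_eq_monomial, coeff_monomial]
  refine ⟨by simp, fun i hi => ?_⟩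
  rw [if_neg (by omega), if_neg (by omega), sub_zero]

theorem X_sub_C_ne_zero (b : F) : X σ δ - C σ δ b ≠ 0 := fun h => by
  have := degree_X_sub_C (σ := σ) (δ := δ) b
  rw [h, (degree_eq_bot _).2 rfl] at this
  exact WithBot.bot_ne_coe this

theorem X_sub_C_injective : Function.Injective fun b => X σ δ - C σ δ b := fun a b h => by
  have := congrArg (fun f => f.coeff 0) h
  simpa [C_eq_monomial, coeff_monomial] using this

theorem exists_eq_mul_X_sub_C_add_C (f : SkewPoly σ δ) (b : F) :
    ∃ q r, f = q * (X σ δ - C σ δ b) + C σ δ r := by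
  obtain ⟨r, hr, q, hq⟩ := exists_remainder f _ (X_sub_C_ne_zero b)
  rw [degree_X_sub_C, degree_lt_iff] at hr
  refine ⟨q, r.coeff 0, ?_⟩
  convert hq using 2
  ext i
  rw [C_eq_monomial, coeff_monomial]
  split_ifs with h
  · rw [h]
  · exact (hr i (by omega)).symm

/-- A left multiple of `p` of degree less than that of `p` is zero. -/
theorem eq_zero_of_mem_span_of_degree_lt {f p : SkewPoly σ δ}
    (hf : f ∈ Submodule.span (SkewPoly σ δ) {p}) (h : f.degree < p.degree) : f = 0 := by
  obtain ⟨q, hq⟩ := Submodule.mem_span_singleton.1 hf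
  have hp : (0 : SkewPoly σ δ).degree < p.degree := by
    rw [(degree_eq_bot _).2 rfl]; exact bot_le.trans_lt h
  exact remainder_unique p f 0 0 q h hp (by rw [zero_mul, zero_add, add_zero, ← hq, smul_eq_mul])

theorem C_mem_span_X_sub_C {r b : F} :
    C σ δ r ∈ Submodule.span (SkewPoly σ δ) {X σ δ - C σ δ b} ↔ r = 0 := by
  refine ⟨fun h => ?_, fun h => by rw [h, map_zero]; exact zero_mem _⟩
  have h0 : C σ δ r = 0 := by
    refine eq_zero_of_mem_span_of_degree_lt h ?_
    rw [degree_X_sub_C, degree_lt_iff]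
    intro i hi
    rw [C_eq_monomial, coeff_monomial, if_neg (by omega)]
  have := congrArg (fun f => f.coeff 0) h0
  simpa [C_eq_monomial, coeff_monomial] using this

theorem eval_eq_zero_iff_mem_span (f p : SkewPoly σ δ) :
    eval f p = 0 ↔ f ∈ Submodule.span (SkewPoly σ δ) {p} := by
  rw [eval_zero_iff, Submodule.mem_span_singleton]
  exact exists_congr fun q => eq_comm

section Module

variable {N : Type*} [AddCommGroup N] [Module (SkewPoly σ δ) N]

theorem X_smul_eq_of_X_sub_C_smul_eq_zero {c : F} {w : N} (hw : (X σ δ - C σ δ c) • w = 0) :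
    X σ δ • w = C σ δ c • w := by
  rwa [sub_smul, sub_eq_zero] at hw

/-- Move `x` past `γ` by the commutation rule and let it act on `w` as `c`. For `γ ≠ 0` and `w ≠ 0`,
the vanishing of the coefficient says that `b` is the conjugate of `c` by `γ`. -/
theorem X_sub_C_smul_C_smul {c : F} {w : N} (hw : (X σ δ - C σ δ c) • w = 0) (b γ : F) :
    (X σ δ - C σ δ b) • C σ δ γ • w = C σ δ (σ γ * c + δ γ - b * γ) • w := by
  rw [smul_smul, sub_mul, X_mul_C, sub_smul, add_smul, mul_smul,
    X_smul_eq_of_X_sub_C_smul_eq_zero hw]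
  simp only [map_sub, map_add, map_mul, sub_smul, add_smul, mul_smul]

theorem C_smul_eq_zero_iff {γ : F} {w : N} (hw : w ≠ 0) : C σ δ γ • w = 0 ↔ γ = 0 := by
  refine ⟨fun h => ?_, fun h => by rw [h, map_zero, zero_smul]⟩
  by_contra hγ
  apply hw
  rw [← one_smul (SkewPoly σ δ) w, ← map_one (C σ δ), ← inv_mul_cancel₀ hγ, map_mul, mul_smul, h,
    smul_zero]

/-- A simple module with a non-zero vector killed by `x - b` is one-dimensional over `F`. -/
theorem exists_C_smul_eq [IsSimpleModule (SkewPoly σ δ) N] {b : F} {u : N} (hu : u ≠ 0)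
    (hb : (X σ δ - C σ δ b) • u = 0) (v : N) : ∃ γ, C σ δ γ • u = v := by
  obtain ⟨f, hf⟩ := IsSimpleModule.toSpanSingleton_surjective (SkewPoly σ δ) hu v
  obtain ⟨q, r, hqr⟩ := exists_eq_mul_X_sub_C_add_C f b
  refine ⟨r, ?_⟩
  rw [LinearMap.toSpanSingleton_apply, hqr, add_smul, mul_smul, hb, smul_zero, zero_add] at hf
  exact hf

end Module

/-! ### Maximal left ideals above a product of linear factors -/

/-- A proper left ideal containing `x - b` is generated by it. -/
theorem eq_span_X_sub_C {m : Submodule (SkewPoly σ δ) (SkewPoly σ δ)} (hm : m ≠ ⊤) {b : F}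
    (hb : X σ δ - C σ δ b ∈ m) : m = Submodule.span (SkewPoly σ δ) {X σ δ - C σ δ b} := by
  refine le_antisymm (fun f hf => ?_) ((Submodule.span_singleton_le_iff_mem _ _).2 hb)
  obtain ⟨q, r, rfl⟩ := exists_eq_mul_X_sub_C_add_C f b
  have hr : C σ δ r ∈ m := (Submodule.add_mem_iff_right m (m.smul_mem q hb)).1 hf
  have h0 : r = 0 := by
    by_contra h0
    apply hm
    refine (Ideal.eq_top_iff_one m).2 ?_
    rw [← map_one (C σ δ), ← inv_mul_cancel₀ h0, map_mul]
    exact m.smul_mem _ hr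
  rw [h0, map_zero, add_zero]
  exact Submodule.smul_mem _ _ (Submodule.mem_span_singleton_self _)

/-- The maximal left ideals containing a product of linear factors are generated by linear
skew polynomials. -/
theorem exists_eq_span_X_sub_C_of_seqPoly_mem {m : Submodule (SkewPoly σ δ) (SkewPoly σ δ)}
    (hm : IsCoatom m) {r : ℕ} (a : Fin r → F) (ha : seqPoly σ δ a ∈ m) :
    ∃ b, m = Submodule.span (SkewPoly σ δ) {X σ δ - C σ δ b} := by
  induction r with
  | zero => exact absurd ((Ideal.eq_top_iff_one m).2 ha) hm.1
  | succ r ih =>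
    -- If the shorter right factor is not in `m`, its class in `R / m` is a non-zero vector killed
    -- by the last linear factor, so this simple module is one-dimensional over `F`.
    by_cases h : seqPoly σ δ (fun i : Fin r => a i.castSucc) ∈ m
    · exact ih _ h
    have : IsSimpleModule (SkewPoly σ δ) (SkewPoly σ δ ⧸ m) := isSimpleModule_iff_isCoatom.2 hm
    have hu : m.mkQ (seqPoly σ δ fun i : Fin r => a i.castSucc) ≠ 0 :=
      fun h0 => h ((Submodule.Quotient.mk_eq_zero m).1 h0)
    have hu' : (X σ δ - C σ δ (a (Fin.last r))) •
        m.mkQ (seqPoly σ δ fun i : Fin r => a i.castSucc) = 0 := by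
      rw [← map_smul]
      exact (Submodule.Quotient.mk_eq_zero m).2 ha
    obtain ⟨γ, hγ⟩ := exists_C_smul_eq hu hu' (m.mkQ 1)
    have hγ0 : γ ≠ 0 := by
      rintro rfl
      rw [map_zero, zero_smul] at hγ
      exact hm.1 ((Ideal.eq_top_iff_one m).2 ((Submodule.Quotient.mk_eq_zero m).1 hγ.symm))
    -- The class of `1` is `γ` times that vector, so it is killed by `x - b` for `b` the conjugate
    -- of the last entry by `γ`; this puts `x - b` in `m`.
    refine ⟨(σ γ * a (Fin.last r) + δ γ) * γ⁻¹, eq_span_X_sub_C hm.1 ?_⟩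
    refine (Submodule.Quotient.mk_eq_zero m).1 ?_
    rw [← mul_one (X σ δ - C σ δ _), ← smul_eq_mul]
    change (X σ δ - C σ δ _) • m.mkQ 1 = 0
    rw [← hγ, X_sub_C_smul_C_smul hu', inv_mul_cancel_right₀ hγ0, sub_self, map_zero, zero_smul]

theorem seqPoly_ne_zero {r : ℕ} (a : Fin r → F) : seqPoly σ δ a ≠ 0 := by
  suffices (seqPoly σ δ a).degree = (r : ℕ) by
    intro h
    rw [h, (degree_eq_bot _).2 rfl] at this
    exact WithBot.bot_ne_coe this
  induction r with
  | zero =>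
    refine (degree_eq_iff _ 0).2 ?_
    simp only [seqPoly, one_def, coeff_monomial]
    exact ⟨by simp, fun i hi => if_neg (by omega)⟩
  | succ r ih =>
    rw [seqPoly, degree_mul, ih, degree_X_sub_C, add_comm r 1]
    rfl

/-- For a multiplicity sequence `a`, the left ideal of `x - a_1` is the only maximal one containing
`P_a`. -/
theorem IsMultiplicitySeq.eq_span_of_isCoatom {r : ℕ} {a : Fin r → F}
    (ha : IsMultiplicitySeq σ δ a) (hr : 0 < r) {m : Submodule (SkewPoly σ δ) (SkewPoly σ δ)}
    (hm : IsCoatom m) (h : seqPoly σ δ a ∈ m) :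
    m = Submodule.span (SkewPoly σ δ) {X σ δ - C σ δ (a ⟨0, hr⟩)} := by
  obtain ⟨b, rfl⟩ := exists_eq_span_X_sub_C_of_seqPoly_mem hm a h
  have hb : b ∈ zeros (seqPoly σ δ a) := (eval_eq_zero_iff_mem_span _ _).2 h
  obtain ⟨_, h'⟩ := ha
  rw [h'] at hb
  rw [Set.mem_singleton_iff.1 hb]

theorem IsMultiplicitySeq.mem_span {r : ℕ} {a : Fin r → F}
    (ha : IsMultiplicitySeq σ δ a) (hr : 0 < r) :
    seqPoly σ δ a ∈ Submodule.span (SkewPoly σ δ) {X σ δ - C σ δ (a ⟨0, hr⟩)} := by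
  obtain ⟨_, h⟩ := ha
  refine (eval_eq_zero_iff_mem_span _ _).1 ?_
  have : a ⟨0, hr⟩ ∈ zeros (seqPoly σ δ a) := h ▸ Set.mem_singleton _
  exact this

/-! ### Degrees and dimensions -/

theorem coeff_sum {ι : Type*} (s : Finset ι) (f : ι → SkewPoly σ δ) (j : ℕ) :
    (∑ i ∈ s, f i).coeff j = ∑ i ∈ s, (f i).coeff j :=
  map_sum (⟨⟨fun f : SkewPoly σ δ => f.coeff j, rfl⟩, fun _ _ => rfl⟩ : SkewPoly σ δ →+ F) f s

theorem coeff_linearCombination_monomial {d : ℕ} (v : Fin d → F) (j : ℕ) :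
    (Fintype.linearCombination F (fun i : Fin d => monomial σ δ i 1) v).coeff j =
      if h : j < d then v ⟨j, h⟩ else 0 := by
  rw [Fintype.linearCombination_apply, coeff_sum]
  simp only [smul_monomial, mul_one, coeff_monomial]
  split_ifs with h
  · rw [Finset.sum_eq_single ⟨j, h⟩]
    · simp
    · intro i _ hi
      exact if_neg fun h' => hi (Fin.ext h')
    · simp
  · exact Finset.sum_eq_zero fun i _ => if_neg fun h' : (i : ℕ) = j => h (h' ▸ i.2)

/-- Skew polynomials of degree less than `d` are the normal forms modulo `p`, if `d` is the degree
of `p`. -/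
noncomputable def quotientSpanEquiv {p : SkewPoly σ δ} {d : ℕ} (hp : p.degree = d) :
    (Fin d → F) ≃ₗ[F] SkewPoly σ δ ⧸ Submodule.span (SkewPoly σ δ) {p} :=
  LinearEquiv.ofBijective
    ((Submodule.mkQ (Submodule.span (SkewPoly σ δ) {p})).restrictScalars F ∘ₗ
      Fintype.linearCombination F (fun i : Fin d => monomial σ δ i 1)) <| by
    constructor
    · rw [← LinearMap.ker_eq_bot, LinearMap.ker_eq_bot']
      intro v hv
      have h0 := eq_zero_of_mem_span_of_degree_lt ((Submodule.Quotient.mk_eq_zero _).1 hv)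
        (by
          rw [hp, degree_lt_iff]
          intro i hi
          rw [coeff_linearCombination_monomial, dif_neg (by omega)])
      funext i
      have := coeff_linearCombination_monomial (σ := σ) (δ := δ) v i
      rw [h0, dif_pos i.2] at this
      exact this.symm
    · intro y
      obtain ⟨f, rfl⟩ := Submodule.mkQ_surjective _ y
      have hp0 : p ≠ 0 := by
        rintro rfl
        rw [(degree_eq_bot _).2 rfl] at hp
        exact WithBot.bot_ne_coe hp
      obtain ⟨g, hg, q, hq⟩ := exists_remainder f p hp0
      rw [hp, degree_lt_iff] at hg
      refine ⟨fun i => g.coeff i, ?_⟩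
      have hgv : Fintype.linearCombination F (fun i : Fin d => monomial σ δ i 1)
          (fun i => g.coeff i) = g := by
        ext j
        rw [coeff_linearCombination_monomial]
        split_ifs with h
        · rfl
        · exact (hg j (by omega)).symm
      rw [LinearMap.comp_apply, hgv]
      refine (Submodule.Quotient.eq _).2 ?_
      rw [hq, sub_add_cancel_right, neg_mem_iff]
      exact Submodule.smul_mem _ q (Submodule.mem_span_singleton_self p)

/-- Gives algebraicity of finite sets: an injective diagonal map would embed the ring in a
finite-dimensional space. -/
theorem not_module_finite : ¬ Module.Finite F (SkewPoly σ δ) := fun h => by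
  have h' : Module.Finite F (ℕ →₀ F) := h
  have := Module.Finite.finite_basis (Finsupp.basisSingleOne (R := F) (ι := ℕ))
  exact not_finite ℕ

theorem mem_vanishing_iff {n : ℕ} (p : Fin n → SkewPoly σ δ) (f : SkewPoly σ δ) :
    f ∈ vanishing (Set.range p) ↔ f ∈ LinearMap.ker
      (LinearMap.pi fun i => (Submodule.span (SkewPoly σ δ) {p i}).mkQ) := by
  rw [LinearMap.mem_ker, funext_iff, vanishing]
  simp only [Set.mem_ofPred_eq, Set.forall_mem_range, eval_eq_zero_iff_mem_span]
  exact forall_congr' fun i => (Submodule.Quotient.mk_eq_zero _).symm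

/-- The set of the `p i` is P-independent if and only if every system of congruences
`f ≡ g i mod p i` has a solution. -/
theorem pIndependent_range_iff {n : ℕ} {U : Set (SkewPoly σ δ)} {p : Fin n → SkewPoly σ δ}
    (hinj : Function.Injective p) (hU : ∀ i, p i ∈ U) (h0 : ∀ i, p i ≠ 0) :
    PIndependent U (Set.range p) ↔ Function.Surjective
      (LinearMap.pi fun i => (Submodule.span (SkewPoly σ δ) {p i}).mkQ) := by
  choose d hd using fun i => exists_degree_eq (h0 i)
  have hfinite : ∀ i, Module.Finite F (SkewPoly σ δ ⧸ Submodule.span (SkewPoly σ δ) {p i}) :=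
    fun i => Module.Finite.equiv (quotientSpanEquiv (hd i))
  have hrank : Module.finrank F (∀ i, SkewPoly σ δ ⧸ Submodule.span (SkewPoly σ δ) {p i}) =
      ∑ i, d i := by
    rw [Module.finrank_pi_fintype]
    exact Finset.sum_congr rfl fun i _ => by
      rw [← (quotientSpanEquiv (hd i)).finrank_eq, Module.finrank_fin_fun]
  set Φ := LinearMap.pi fun i => (Submodule.span (SkewPoly σ δ) {p i}).mkQ with hΦ
  have halg : Algebraic (Set.range p) := fun h => by
    refine not_module_finite (σ := σ) (δ := δ) ?_
    refine Module.Finite.of_injective (Φ.restrictScalars F) ?_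
    rw [← LinearMap.ker_eq_bot, LinearMap.ker_eq_bot']
    intro f hf
    have : f ∈ vanishing (Set.range p) := (mem_vanishing_iff p f).2 hf
    rw [h] at this
    exact this
  obtain ⟨h1, ⟨N, hN, -⟩, h3⟩ := minPoly_spec halg
  -- The remainder of a vanishing `f` modulo `F_Ω` vanishes too and has smaller degree, so
  -- minimality makes it zero.
  have hker : LinearMap.ker Φ = Submodule.span (SkewPoly σ δ) {minPoly (Set.range p)} := by
    refine le_antisymm (fun f hf => ?_) ((Submodule.span_singleton_le_iff_mem _ _).2
      ((mem_vanishing_iff p _).1 h1))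
    have hm0 : minPoly (Set.range p) ≠ 0 := by
      intro h
      rw [h, (degree_eq_bot _).2 rfl] at hN
      exact WithBot.bot_ne_coe hN
    obtain ⟨g, hg, q, rfl⟩ := exists_remainder f _ hm0
    have hq : q * minPoly (Set.range p) ∈ LinearMap.ker Φ :=
      Submodule.smul_mem _ q ((mem_vanishing_iff p _).1 h1)
    have hg' := (Submodule.add_mem_iff_right _ hq).1 hf
    have hg0 : g = 0 := by
      by_contra hg0
      exact absurd hg (not_lt.2 (h3 g ((mem_vanishing_iff p g).2 hg') hg0))
    rw [hg0, add_zero]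
    exact Submodule.smul_mem _ q (Submodule.mem_span_singleton_self _)
  have hrange : Module.finrank F (LinearMap.range (Φ.restrictScalars F)) = N := by
    have e1 := (Submodule.quotEquivOfEq _ _ hker).restrictScalars F
    have e2 := (LinearMap.quotKerEquivRange Φ).restrictScalars F
    have h := ((quotientSpanEquiv hN).trans (e1.symm.trans e2)).finrank_eq
    rw [Module.finrank_fin_fun] at h
    exact h.symm
  have hsurj : Function.Surjective Φ ↔ N = ∑ i, d i := by
    rw [← hrank, ← hrange]
    refine ⟨fun h => ?_, fun h => ?_⟩
    · rw [LinearMap.range_eq_top.2 (show Function.Surjective (Φ.restrictScalars F) from h),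
        finrank_top]
    · have h' : LinearMap.range (Φ.restrictScalars F) = ⊤ := Submodule.eq_top_of_finrank_eq h
      exact (LinearMap.range_eq_top (f := Φ.restrictScalars F)).1 h'
  have hsum : ∀ hfin : (Set.range p).Finite,
      ∑ q ∈ hfin.toFinset, q.degree = ((∑ i, d i : ℕ) : WithBot ℕ) := fun hfin => by
    classical
    -- Injectivity of `p` matters here: the sum over the set counts each polynomial once.
    have : hfin.toFinset = Finset.univ.image p := by ext; simp
    rw [this, Finset.sum_image hinj.injOn, Nat.cast_sum]
    exact Finset.sum_congr rfl fun i _ => hd i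
  rw [hsurj]
  refine ⟨fun ⟨_, _, hfin, h⟩ => ?_, fun h => ⟨?_, halg, Set.finite_range p, ?_⟩⟩
  · rw [hsum, hN] at h
    exact WithBot.coe_injective h
  · rintro _ ⟨i, rfl⟩
    exact hU i
  · rw [hsum, hN, h]

/-! ### Conjugacy and P-independence of points -/

theorem conj_mul_self (c : F) {β : F} (hβ : β ≠ 0) : conj σ δ c β * β = σ β * c + δ β := by
  rw [conj, ← add_mul, inv_mul_cancel_right₀ hβ]

theorem eq_conj_iff {c b β : F} (hβ : β ≠ 0) : b = conj σ δ c β ↔ σ β * c + δ β = b * β := by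
  rw [← conj_mul_self c hβ, mul_left_inj' hβ, eq_comm]

theorem mem_centralizer {c κ : F} : κ ∈ centralizer σ δ c ↔ σ κ * c + δ κ = c * κ := Iff.rfl

/-- Right multiplication by the centralizer commutes with the action of `x`. -/
theorem map_mul_add_of_mem_centralizer {c κ : F} (hκ : κ ∈ centralizer σ δ c) (β : F) :
    σ (β * κ) * c + δ (β * κ) = (σ β * c + δ β) * κ := by
  rw [map_mul, δ.leibniz, mul_assoc, ← add_assoc, ← mul_add, mem_centralizer.1 hκ, add_mul,
    mul_assoc]

/-- If `b` is the conjugate of `d` by `β` and of `c` by `γ`, then `d` is the conjugate of `c` by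
`β⁻¹ γ`. -/
theorem map_inv_mul_mul_add {c d β γ : F} (hβ : β ≠ 0)
    (h : σ γ * c + δ γ = conj σ δ d β * γ) :
    σ (β⁻¹ * γ) * c + δ (β⁻¹ * γ) = d * (β⁻¹ * γ) := by
  have hσ : σ β ≠ 0 := (map_ne_zero σ).2 hβ
  -- The Leibniz rule applied to `γ = β (β⁻¹ γ)`.
  have h1 : σ γ * c + δ γ = σ β * (σ (β⁻¹ * γ) * c + δ (β⁻¹ * γ)) + δ β * (β⁻¹ * γ) := by
    conv_lhs => rw [← mul_inv_cancel_left₀ hβ γ]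
    rw [map_mul σ β, δ.leibniz β, mul_add, mul_assoc, add_assoc]
  apply mul_left_cancel₀ hσ
  rw [← add_left_inj (δ β * (β⁻¹ * γ)), ← h1, h, conj]
  simp only [add_mul, mul_assoc]

/-- A scalar of the opposite ring acts on `F` by right multiplication, so unwrapping it gives the
usual relations with coefficients on the right. -/
theorem rightLinearIndependent_iff {ι : Type*} [Fintype ι] {K : Subfield F} {β : ι → F} :
    RightLinearIndependent K β ↔
      ∀ k : ι → F, (∀ j, k j ∈ K) → ∑ j, β j * k j = 0 → ∀ j, k j = 0 := by
  rw [RightLinearIndependent, Fintype.linearIndependent_iff]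
  constructor
  · intro h k hk h0 j
    have := h (fun j => ⟨MulOpposite.op (k j), hk j⟩) h0 j
    exact MulOpposite.op_injective (congrArg Subtype.val this)
  · intro h g h0 j
    exact Subtype.ext (MulOpposite.unop_injective
      (h (fun j => (g j).1.unop) (fun j => (g j).2) h0 j))

/-- Density: the congruences modulo the `x - c_i ^ β_{i,j}` can be solved simultaneously if and
only if the `β_{i,j}` are right independent over the centralizers, for pairwise non-conjugate
`c_i`. -/
theorem surjective_pi_mkQ_conj_iff {ι : Type*} [Fintype ι] {l : ℕ} {c : Fin l → F}
    (hc : Pairwise fun i j : Fin l => ¬ IsConjugate σ δ (c i) (c j))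
    {m : Fin l → ℕ} {β : (i : Fin l) → Fin (m i) → F} (hβ : ∀ i j, β i j ≠ 0)
    (e : (Σ i, Fin (m i)) ≃ ι) {b : ι → F} (hb : ∀ s, b (e s) = conj σ δ (c s.1) (β s.1 s.2)) :
    Function.Surjective (LinearMap.pi fun k : ι =>
        (Submodule.span (SkewPoly σ δ) {X σ δ - C σ δ (b k)}).mkQ) ↔
      ∀ i : Fin l, RightLinearIndependent (centralizer σ δ (c i)) (β i) := by
  classical
  simp only [rightLinearIndependent_iff]
  constructor
  · intro h i k hk h0 j
    -- `f` is `1` modulo the linear factor of index `(i, j)` and `0` modulo all the others, so it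
    -- isolates one term of the relation.
    obtain ⟨f, hf⟩ := h (Pi.single (e ⟨i, j⟩) (Submodule.mkQ _ 1))
    set I := Submodule.span (SkewPoly σ δ) {X σ δ - C σ δ (c i)}
    set w : SkewPoly σ δ ⧸ I := I.mkQ 1
    have hw0 : w ≠ 0 := fun hw => one_ne_zero (C_mem_span_X_sub_C.1
      ((map_one (C σ δ)).symm ▸ (Submodule.Quotient.mk_eq_zero _).1 hw))
    have hw : (X σ δ - C σ δ (c i)) • w = 0 := by
      rw [← map_smul, smul_eq_mul, mul_one]
      exact (Submodule.Quotient.mk_eq_zero _).2 (Submodule.mem_span_singleton_self _)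
    -- As `k j'` centralizes `c i`, the vector `β i j' * k j'` times `w` is still killed by the
    -- linear factor of `(i, j')`.
    have hv : ∀ j', ∀ g ∈ Submodule.span (SkewPoly σ δ) {X σ δ - C σ δ (b (e ⟨i, j'⟩))},
        g • C σ δ (β i j' * k j') • w = 0 := by
      intro j' g hg
      obtain ⟨q, rfl⟩ := Submodule.mem_span_singleton.1 hg
      rw [smul_assoc, X_sub_C_smul_C_smul hw, map_mul_add_of_mem_centralizer (hk j'), hb,
        ← conj_mul_self (c i) (hβ i j'), mul_assoc, sub_self, map_zero, zero_smul, smul_zero]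
    have hsum : ∑ j', f • C σ δ (β i j' * k j') • w = 0 := by
      rw [← Finset.smul_sum, ← Finset.sum_smul, ← map_sum, h0, map_zero, zero_smul, smul_zero]
    rw [Finset.sum_eq_single j] at hsum
    · have h1 := congrFun hf (e ⟨i, j⟩)
      rw [Pi.single_eq_same] at h1
      have h2 := hv j _ ((Submodule.Quotient.eq _).1 h1)
      rw [sub_smul, hsum, one_smul, zero_sub, neg_eq_zero, C_smul_eq_zero_iff hw0] at h2
      exact (mul_eq_zero.1 h2).resolve_left (hβ i j)
    · intro j' _ hj'
      have h1 := congrFun hf (e ⟨i, j'⟩)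
      rw [Pi.single_eq_of_ne fun h => hj' (by simpa using h)] at h1
      exact hv j' f ((Submodule.Quotient.mk_eq_zero _).1 h1)
    · simp
  · intro h
    by_contra hs
    obtain ⟨L, hL, φ, hker, hφ, k₀, hk₀⟩ := Submodule.exists_of_not_surjective_pi_mkQ _ hs
    have := isSimpleModule_iff_isCoatom.2 hL
    have hu : ∀ k, (X σ δ - C σ δ (b k)) • φ k 1 = 0 := fun k => by
      rw [← map_smul, smul_eq_mul, mul_one]
      exact hker k (Submodule.mem_span_singleton_self _)
    have hu0 : φ k₀ 1 ≠ 0 := fun h1 => hk₀ (LinearMap.ext_ring (by rw [h1, LinearMap.zero_apply]))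
    obtain ⟨⟨i, j⟩, rfl⟩ := e.surjective k₀
    -- Dividing by `β i j` undoes the conjugation: `w` is killed by `x - c i` itself, and it spans
    -- the simple module over `F`.
    set w := C σ δ (β i j)⁻¹ • φ (e ⟨i, j⟩) 1
    have hw0 : w ≠ 0 := fun hw => inv_ne_zero (hβ i j) ((C_smul_eq_zero_iff hu0).1 hw)
    have hw : (X σ δ - C σ δ (c i)) • w = 0 := by
      rw [X_sub_C_smul_C_smul (hu _), hb]
      have h1 := map_inv_mul_mul_add (σ := σ) (δ := δ) (c := conj σ δ (c i) (β i j)) (d := c i)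
        (γ := 1) (hβ i j) (by rw [map_one, δ.map_one, one_mul, mul_one, add_zero])
      rw [mul_one] at h1
      rw [h1, sub_self, map_zero, zero_smul]
    choose γ hγ using fun k => exists_C_smul_eq hw0 hw (φ k 1)
    have hγb : ∀ s, σ (γ (e s)) * c i + δ (γ (e s)) =
        conj σ δ (c s.1) (β s.1 s.2) * γ (e s) := fun s => by
      have h1 := hu (e s)
      rwa [← hγ, X_sub_C_smul_C_smul hw, C_smul_eq_zero_iff hw0, sub_eq_zero, hb] at h1
    -- A non-zero coefficient here would make `c s.1` a conjugate of `c i`, so only the class of `c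
    -- i` contributes.
    have hγ0 : ∀ s, s.1 ≠ i → γ (e s) = 0 := fun s hs => by
      by_contra h0
      have hne := mul_ne_zero (inv_ne_zero (hβ s.1 s.2)) h0
      exact hc hs.symm ⟨_, hne, (eq_conj_iff hne).2 (map_inv_mul_mul_add (hβ s.1 s.2) (hγb s))⟩
    have hsum : ∑ j', γ (e ⟨i, j'⟩) = 0 := by
      have h1 := hφ 1
      rw [Finset.sum_congr rfl fun k _ => (hγ k).symm, ← Finset.sum_smul, ← map_sum,
        C_smul_eq_zero_iff hw0, ← e.sum_comp, Fintype.sum_sigma,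
        Finset.sum_eq_single i (fun i' _ hi' => Finset.sum_eq_zero fun j' _ => hγ0 ⟨i', j'⟩ hi')
          (by simp)] at h1
      exact h1
    -- Within the class, `β⁻¹ γ` conjugates `c i` to itself or is zero, hence lies in the
    -- centralizer; `∑ γ = 0` becomes a right linear relation between the `β i j'`.
    have h1 := h i (fun j' => (β i j')⁻¹ * γ (e ⟨i, j'⟩))
      (fun j' => map_inv_mul_mul_add (hβ i j') (hγb ⟨i, j'⟩))
      (by simpa only [mul_inv_cancel_left₀ (hβ i _)] using hsum) j
    have h2 : γ (e ⟨i, j⟩) = 0 := (mul_eq_zero.1 h1).resolve_left (inv_ne_zero (hβ i j))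
    apply hu0
    rw [← hγ, h2, map_zero, zero_smul]

end SkewPoly

/-! ### Matching the indices and assembling the equivalences -/

/-- A surjection between families of the same size, the second injective, matches their indices. -/
theorem exists_equiv_of_range_eq {α ι κ : Type*} [Fintype ι] [Fintype κ] {f : ι → α} {g : κ → α}
    (hf : Function.Injective f) (h : Set.range f = Set.range g)
    (hcard : Fintype.card ι = Fintype.card κ) : ∃ e : κ ≃ ι, ∀ k, f (e k) = g k := by
  choose e he using fun k => (h ▸ Set.mem_range_self k : g k ∈ Set.range f)
  have hsurj : Function.Surjective e := fun i => by
    obtain ⟨k, hk⟩ := (h ▸ Set.mem_range_self i : f i ∈ Set.range g)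
    exact ⟨k, hf ((he k).trans hk)⟩
  exact ⟨Equiv.ofBijective e
    ((Fintype.bijective_iff_surjective_and_card e).2 ⟨hsurj, hcard.symm⟩), he⟩

theorem mainTheorem1 {F : Type*} [DivisionRing F] (σ : F →+* F) (δ : SigmaDerivation σ)
    {n : ℕ} (r : Fin n → ℕ) (hr : ∀ i, 0 < r i) (a : (i : Fin n) → Fin (r i) → F)
    (ha : ∀ i, SkewPoly.IsMultiplicitySeq σ δ (a i))
    (hdist : Function.Injective fun i : Fin n => a i ⟨0, hr i⟩)
    {l : ℕ} (c : Fin l → F)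
    (hc : Pairwise fun i j : Fin l => ¬ SkewPoly.IsConjugate σ δ (c i) (c j))
    (m : Fin l → ℕ) (hm : ∀ i, 0 < m i) (β : (i : Fin l) → Fin (m i) → F)
    (hβ : ∀ i j, β i j ≠ 0)
    (hclass : (Set.range fun i : Fin n => a i ⟨0, hr i⟩) =
      ⋃ i : Fin l, Set.range fun j : Fin (m i) => SkewPoly.conj σ δ (c i) (β i j))
    (hn : n = ∑ i : Fin l, m i) :
    List.TFAE
      [SkewPoly.PIndependent (SkewPoly.univ₂ σ δ)
          (Set.range fun i : Fin n => SkewPoly.seqPoly σ δ (a i)),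
        SkewPoly.PIndependentPoints σ δ (Set.range fun i : Fin n => a i ⟨0, hr i⟩),
        ∀ i : Fin l, SkewPoly.RightLinearIndependent (SkewPoly.centralizer σ δ (c i)) (β i)] := by
  have hS : Set.range (fun i : Fin n => a i ⟨0, hr i⟩) =
      Set.range fun s : Σ i, Fin (m i) => SkewPoly.conj σ δ (c s.1) (β s.1 s.2) := by
    rw [hclass, Set.range_sigma_eq_iUnion_range]
  -- The count `n = ∑ m i` forces the listed conjugates to be pairwise distinct, one for each first
  -- entry.
  obtain ⟨e, he⟩ := exists_equiv_of_range_eq hdist hS (by simp [hn])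
  have h23 := SkewPoly.surjective_pi_mkQ_conj_iff hc hβ e (b := fun i => a i ⟨0, hr i⟩) he
  have hpoints := SkewPoly.pIndependent_range_iff (U := SkewPoly.univ₀ σ δ)
    (SkewPoly.X_sub_C_injective.comp hdist) (fun i => ⟨_, rfl⟩)
    fun i => SkewPoly.X_sub_C_ne_zero (σ := σ) (δ := δ) (a i ⟨0, hr i⟩)
  -- The first entry is recovered from `P_a` as its only zero, so distinct first entries give
  -- distinct polynomials.
  have hseq_inj : Function.Injective fun i => SkewPoly.seqPoly σ δ (a i) := fun i j hij => by
    obtain ⟨_, hi⟩ := ha i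
    obtain ⟨_, hj⟩ := ha j
    have hij' : SkewPoly.seqPoly σ δ (a i) = SkewPoly.seqPoly σ δ (a j) := hij
    rw [hij', hj] at hi
    exact hdist (Set.singleton_injective hi).symm
  have hseq := SkewPoly.pIndependent_range_iff (U := SkewPoly.univ₂ σ δ) hseq_inj
    (fun i => ⟨r i, a i, ha i, rfl⟩) fun i => SkewPoly.seqPoly_ne_zero (a i)
  rw [SkewPoly.PIndependentPoints, ← Set.range_comp]
  tfae_have 2 ↔ 3 := hpoints.trans h23
  tfae_have 1 → 2 := fun h => by
    refine hpoints.2 fun y => ?_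
    choose g hg using fun i => Submodule.mkQ_surjective _ (y i)
    obtain ⟨f, hf⟩ := hseq.1 h fun i => Submodule.mkQ _ (g i)
    refine ⟨f, funext fun i => ?_⟩
    rw [← hg]
    -- A congruence modulo `P_a` implies the one modulo its right factor `x - a_1`.
    exact (Submodule.Quotient.eq _).2 ((Submodule.span_singleton_le_iff_mem _ _).2
      ((ha i).mem_span (hr i)) ((Submodule.Quotient.eq _).1 (congrFun hf i)))
  tfae_have 2 → 1 := fun h => hseq.2 <|
    Submodule.surjective_pi_mkQ_of_forall_isCoatom _ _
      (fun i _ hm h => (ha i).eq_span_of_isCoatom (hr i) hm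
        ((Submodule.span_singleton_le_iff_mem _ _).1 h)) (hpoints.1 h)
  tfae_finish
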